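/- Let $\alpha\ge\omega$ be an ordinal. Algebras of the type of quasi-polyadic equality algebras of dimension $\alpha$ have Boolean operations $+,\cdot,-,0,1$, constants $\mathsf d_{ij}$ (the diagonal elements) and unary operations $\mathsf c_i,\ \mathsf s_{[i/j]},\ \mathsf s_{[i,j]}$ for $i,j<\alpha$. The full set algebra with base $U$ has as universe the power set of ${}^{\alpha}U$, the set-theoretic Boolean operations, and $$\mathsf d_{ij}=\{s: s_i=s_j\},\qquad \mathsf c_iX=\{s: s'\in X \text{ for some } s'\in{}^{\alpha}U \text{ with } s'_k=s_k \text{ for all } k\neq i\},\qquad \mathsf s_{\tau}X=\{s: s\circ\tau\in X\},$$ where $[i/j]$ maps $i$ to $j$ and fixes everything else, and $[i,j]$ is the transposition of $i$ and $j$. Let $\mathsf{RQEA}_\alpha$ be the class of all algebras of this type that are isomorphic to subalgebras of direct products of full set algebras. A set $\Sigma$ of quantifier-free formulas (first-order, with equality, in this signature) axiomatizes $\mathsf{RQEA}_\alpha$ if an algebra of this type belongs to $\mathsf{RQEA}_\alpha$ exactly when every formula of $\Sigma$ is true in it under all assignments. **Theorem.** Let $\alpha\ge\omega$. 1. $\mathsf{RQEA}_\alpha$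 cannot be axiomatized by a set of quantifier-free formulas in which only finitely many variables occur. 2. For every $k<\omega$, every set $\Sigma$ of quantifier-free formulas axiomatizing $\mathsf{RQEA}_\alpha$ contains a formula with more than $k$ variables in which some diagonal element occurs. 3. $\mathsf{RQEA}_\alpha$ is not axiomatizable over its diagonal-free reduct by universal formulas in finitely many variables: there is no set $\Sigma$ of quantifier-free formulas in which only finitely many variables occur such that, for every algebra $\mathfrak A$ of this type whose diagonal-free reduct embeds into a direct product of diagonal-free reducts of full set algebras, $\mathfrak A\in\mathsf{RQEA}_\alpha$ if and only if every formula of $\Sigma$ is true in $\mathfrak A$ under all assignments. -/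

import Mathlib

universe u

/-! Quasi-polyadic equality algebras of dimension `ι`: signature, concrete set algebras,
representability, and axiomatization by quantifier-free formulas. -/

namespace QEA

/-- The operation symbols of quasi-polyadic equality algebras with index set `ι`, by arity:
the Boolean operations, the diagonal constants `d i j`, the cylindrifications `c i`, the
replacement operations `s [i/j]` and the transposition operations `s [i,j]`. -/
inductive Op (ι : Type u) : ℕ → Type u
  | zero : Op ι 0
  | one : Op ι 0
  | diag (i j : ι) : Op ι 0
  | compl : Op ι 1
  | cyl (i : ι) : Op ι 1
  | repl (i j : ι) : Op ι 1
  | swap (i j : ι) : Op ι 1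
  | sup : Op ι 2
  | inf : Op ι 2

/-- `f` is one of the diagonal constants. -/
def Op.IsDiag {ι : Type u} : {n : ℕ} → Op ι n → Prop
  | _, .diag _ _ => True
  | _, _ => False

/-- The algebraic first-order language of quasi-polyadic equality algebras of dimension `ι`. An
algebra of this similarity type is a type `A` with an instance of `(QEA.lang ι).Structure A`. -/
def lang (ι : Type u) : FirstOrder.Language.{u, 0} where
  Functions := Op ι
  Relations := fun _ => Empty

open Classical in
/-- The operations of the full set algebra with base `U`, on the set of all subsets of the
Cartesian space of `ι`-sequences in `U`. For a transformation `τ` of `ι`, the substitution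
operation `s τ` sends `X` to the set of all `s` with `s ∘ τ ∈ X`; here `τ` is the replacement
`[i/j]`, sending `i` to `j` and fixing everything else, or the transposition `[i,j]`. -/
def setOp {ι : Type u} {U : Type u} : {n : ℕ} → Op ι n → (Fin n → Set (ι → U)) → Set (ι → U)
  | _, .zero, _ => ∅
  | _, .one, _ => Set.univ
  | _, .diag i j, _ => {s | s i = s j}
  | _, .compl, X => (X 0)ᶜ
  | _, .cyl i, X => {s | ∃ a : U, Function.update s i a ∈ X 0}
  | _, .repl i j, X => {s | s ∘ Function.update id i j ∈ X 0}
  | _, .swap i j, X => {s | s ∘ Equiv.swap i j ∈ X 0}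
  | _, .sup, X => X 0 ∪ X 1
  | _, .inf, X => X 0 ∩ X 1

/-- The full quasi-polyadic equality set algebra of dimension `ι` with base `U`. -/
instance fullSetAlgebra (ι U : Type u) : (lang ι).Structure (Set (ι → U)) where
  funMap := fun f X => setOp f X
  RelMap := fun r _ => r.elim

/-- `A` is representable: it is isomorphic to a subalgebra of a direct product of full
quasi-polyadic equality set algebras of dimension `ι`, that is, there is an injection of `A` into
such a product which preserves all operations. -/
def IsRepresentable (ι : Type u) (A : Type u) [(lang ι).Structure A] : Prop :=
  ∃ (J : Type u) (U : J → Type u) (h : A → (j : J) → Set (ι → U j)),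
    Function.Injective h ∧
      ∀ (n : ℕ) (f : (lang ι).Functions n) (x : Fin n → A) (j : J),
        h (FirstOrder.Language.Structure.funMap f x) j =
          FirstOrder.Language.Structure.funMap f (fun i => h (x i) j)

/-- The diagonal-free reduct of `A` is a representable quasi-polyadic algebra: there is an
injection of `A` into a direct product of full set algebras which preserves all operations other
than the diagonal elements. -/
def IsDiagFreeRepresentable (ι : Type u) (A : Type u) [(lang ι).Structure A] : Prop :=
  ∃ (J : Type u) (U : J → Type u) (h : A → (j : J) → Set (ι → U j)),
    Function.Injective h ∧
      ∀ (n : ℕ) (f : (lang ι).Functions n), ¬ Op.IsDiag f → ∀ (x : Fin n → A) (j : J),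
        h (FirstOrder.Language.Structure.funMap f x) j =
          FirstOrder.Language.Structure.funMap f (fun i => h (x i) j)

/-- Some diagonal constant occurs in the term. -/
def TermHasDiag {ι : Type u} {β : Type} : (lang ι).Term β → Prop
  | .var _ => False
  | .func f ts => Op.IsDiag f ∨ ∃ i, TermHasDiag (ts i)

/-- Some diagonal constant occurs in the formula. -/
def HasDiag {ι : Type u} {β : Type} : {n : ℕ} → (lang ι).BoundedFormula β n → Prop
  | _, .falsum => False
  | _, .equal t₁ t₂ => TermHasDiag t₁ ∨ TermHasDiag t₂
  | _, .rel _ ts => ∃ i, TermHasDiag (ts i)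
  | _, .imp φ ψ => HasDiag φ ∨ HasDiag ψ
  | _, .all φ => HasDiag φ

/-- All formulas of `S` are valid in `A`, that is, true under every assignment of elements of `A`
to the variables. For quantifier-free formulas this is validity of their universal closures. -/
def Models {ι : Type u} (A : Type u) [(lang ι).Structure A] (S : Set ((lang ι).Formula ℕ)) :
    Prop :=
  ∀ φ ∈ S, ∀ v : ℕ → A, φ.Realize v

/-- `S` axiomatizes the class of representable quasi-polyadic equality algebras of dimension
`ι`. -/
def Axiomatizes {ι : Type u} (S : Set ((lang ι).Formula ℕ)) : Prop :=
  ∀ (A : Type u) [(lang ι).Structure A], Models A S ↔ IsRepresentable ι A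

/-- `S` axiomatizes the class of representable quasi-polyadic equality algebras of dimension `ι`
over its diagonal-free reduct: among the algebras whose diagonal-free reduct is representable, the
models of `S` are exactly the representable ones. -/
def AxiomatizesOverDiagFree {ι : Type u} (S : Set ((lang ι).Formula ℕ)) : Prop :=
  ∀ (A : Type u) [(lang ι).Structure A], IsDiagFreeRepresentable ι A →
    (Models A S ↔ IsRepresentable ι A)

end QEA

/-! For each `k` there is a nonrepresentable algebra with representable diagonal-free reduct in
which any `k` elements lie in a representable subalgebra (`exists_nonrepresentable`). Formulas valid
in all representable algebras hold in it if they have at most `k` variables or no diagonals; all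
three claims follow.

The algebra comes from splitting an atom. The group of block permutations of `ι × Y` acts on points
and, regularly, on labels. Among the invariant sets of sequences, the transversals form a single
orbit. `ColAlg` splits this orbit into colours, each with the same cylindrifications as the whole
orbit.

If there are more colours than points in a block, no representation exists. Each colour `c` supplies
a replacement `x c` of one entry of a transversal, while a label names all points of each block. So
every `x c` has one of `|Y|` names, two of them share a name, and the diagonal makes them equal
although their colours are disjoint.

Conversely, a colouring of transversals that takes every required colour when one entry moves within
its block yields a representation (`preimage_colSeq_colOp`). Group-valued sums give such colourings.
Without diagonals the points may be duplicated until blocks are as large as `C`. With diagonals, `k`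
elements distinguish at most `2 ^ k` classes of colours, so blocks of that size suffice. -/

namespace QEA

open FirstOrder Language Function

/-! ### Transfer of quantifier-free formulas. -/

section Logic

variable {ι : Type u}

theorem realize_term_congr {A : Type u} [(lang ι).Structure A] {β : Type} [DecidableEq β] :
    ∀ (t : (lang ι).Term β) {v w : β → A}, (∀ x ∈ t.varFinset, v x = w x) →
      t.realize v = t.realize w
  | .var x, v, w, h => h x (by simp [Term.varFinset])
  | .func f ts, v, w, h => by
    simp only [Term.realize_func]
    congr 1
    funext i
    exact realize_term_congr (ts i) fun x hx => h x (by
      simp only [Term.varFinset, Finset.mem_biUnion]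
      exact ⟨i, Finset.mem_univ _, hx⟩)

theorem mem_varFinsetLeft {β γ : Type} [DecidableEq β] [DecidableEq γ] {x : β} :
    ∀ t : (lang ι).Term (β ⊕ γ), Sum.inl x ∈ t.varFinset → x ∈ t.varFinsetLeft
  | .var (.inl y), h => by simpa [Term.varFinset, Term.varFinsetLeft] using h
  | .var (.inr y), h => by simp [Term.varFinset] at h
  | .func f ts, h => by
    simp only [Term.varFinset, Term.varFinsetLeft, Finset.mem_biUnion] at h ⊢
    obtain ⟨i, hi, hx⟩ := h
    exact ⟨i, hi, mem_varFinsetLeft (ts i) hx⟩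

/-- A quantifier-free formula only sees the values of the assignment at its free variables. -/
theorem realize_congr {A : Type u} [(lang ι).Structure A] {n : ℕ}
    {φ : (lang ι).BoundedFormula ℕ n} (hφ : φ.IsQF) {v w : ℕ → A} {xs : Fin n → A}
    (h : ∀ x ∈ φ.freeVarFinset, v x = w x) : φ.Realize v xs ↔ φ.Realize w xs := by
  induction hφ with
  | falsum => rfl
  | of_isAtomic hat =>
    cases hat with
    | equal t₁ t₂ =>
      simp only [BoundedFormula.freeVarFinset, Finset.mem_union, Term.bdEqual] at h
      simp only [BoundedFormula.realize_bdEqual]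
      rw [realize_term_congr t₁ (w := Sum.elim w xs), realize_term_congr t₂ (w := Sum.elim w xs)]
      · rintro (x | x) hx
        · exact h x (Or.inr (mem_varFinsetLeft t₂ hx))
        · rfl
      · rintro (x | x) hx
        · exact h x (Or.inl (mem_varFinsetLeft t₁ hx))
        · rfl
    | rel r ts => exact r.elim
  | imp _ _ ih₁ ih₂ =>
    simp only [BoundedFormula.freeVarFinset, Finset.mem_union] at h
    simp only [BoundedFormula.realize_imp]
    rw [ih₁ fun x hx => h x (Or.inl hx), ih₂ fun x hx => h x (Or.inr hx)]

variable {A B : Type u} [(lang ι).Structure A] [(lang ι).Structure B]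

theorem realize_term_of_diagFreeHom {h : A → B}
    (hh : ∀ (n : ℕ) (f : (lang ι).Functions n), ¬ Op.IsDiag f → ∀ x : Fin n → A,
      h (Structure.funMap f x) = Structure.funMap f (h ∘ x)) {β : Type} (v : β → A) :
    ∀ t : (lang ι).Term β, ¬ TermHasDiag t → h (t.realize v) = t.realize (h ∘ v)
  | .var _, _ => rfl
  | .func f ts, ht => by
    simp only [TermHasDiag, not_or, not_exists] at ht
    simp only [Term.realize_func]
    rw [hh _ f ht.1]
    congr 1
    funext i
    exact realize_term_of_diagFreeHom hh v (ts i) (ht.2 i)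

/-- Diag-free quantifier-free formulas are preserved by embeddings of the diag-free reducts. -/
theorem realize_of_diagFreeHom {h : A → B} (hinj : Injective h)
    (hh : ∀ (n : ℕ) (f : (lang ι).Functions n), ¬ Op.IsDiag f → ∀ x : Fin n → A,
      h (Structure.funMap f x) = Structure.funMap f (h ∘ x)) {n : ℕ}
    {φ : (lang ι).BoundedFormula ℕ n} (hφ : φ.IsQF) (hd : ¬ HasDiag φ)
    (v : ℕ → A) (xs : Fin n → A) :
    φ.Realize v xs ↔ φ.Realize (h ∘ v) (h ∘ xs) := by
  induction hφ with
  | falsum => rfl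
  | of_isAtomic hat =>
    cases hat with
    | equal t₁ t₂ =>
      simp only [Term.bdEqual, HasDiag, not_or] at hd
      simp only [BoundedFormula.realize_bdEqual, ← Sum.comp_elim]
      rw [← realize_term_of_diagFreeHom hh _ t₁ hd.1, ← realize_term_of_diagFreeHom hh _ t₂ hd.2,
        hinj.eq_iff]
    | rel r ts => exact r.elim
  | imp _ _ ih₁ ih₂ =>
    simp only [HasDiag, not_or] at hd
    simp only [BoundedFormula.realize_imp]
    rw [ih₁ hd.1, ih₂ hd.2]

/-- The product of full set algebras. -/
instance piSetAlgebra (ι : Type u) (J : Type u) (U : J → Type u) :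
    (lang ι).Structure ((j : J) → Set (ι → U j)) where
  funMap := fun f x j => Structure.funMap (L := lang ι) f fun i => x i j
  RelMap := fun r _ => r.elim

theorem isRepresentable_pi (J : Type u) (U : J → Type u) :
    IsRepresentable ι ((j : J) → Set (ι → U j)) :=
  ⟨J, U, id, injective_id, fun _ _ _ _ => rfl⟩

theorem IsRepresentable.isDiagFreeRepresentable (h : IsRepresentable ι A) :
    IsDiagFreeRepresentable ι A := by
  obtain ⟨J, U, h, hi, hh⟩ := h
  exact ⟨J, U, h, hi, fun n f _ x j => hh n f x j⟩

/-- A formula valid in all representable algebras and free of diagonals is valid in every algebra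
with representable diagonal-free reduct. -/
theorem IsDiagFreeRepresentable.realize (hA : IsDiagFreeRepresentable ι A)
    {φ : (lang ι).Formula ℕ} (hφ : φ.IsQF) (hd : ¬ HasDiag φ)
    (hval : ∀ (B : Type u) [(lang ι).Structure B], IsRepresentable ι B →
      ∀ v : ℕ → B, φ.Realize v) (v : ℕ → A) : φ.Realize v := by
  obtain ⟨J, U, h, hi, hh⟩ := hA
  have hh' : ∀ (n : ℕ) (f : (lang ι).Functions n), ¬ Op.IsDiag f → ∀ x : Fin n → A,
      h (Structure.funMap f x) = Structure.funMap f (h ∘ x) := fun n f hf x =>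
    funext fun j => hh n f hf x j
  have := hval _ (isRepresentable_pi J U) (h ∘ v)
  rw [Formula.Realize] at this ⊢
  rw [realize_of_diagFreeHom hi hh' hφ hd]
  convert this using 1

/-- A formula true in a substructure containing the values of its variables is true. -/
theorem realize_of_substructure (S : (lang ι).Substructure A) {φ : (lang ι).Formula ℕ}
    (hφ : φ.IsQF) (hS : ∀ w : ℕ → S, φ.Realize w) (v : ℕ → A)
    (hv : ∀ x ∈ φ.freeVarFinset, v x ∈ S) : φ.Realize v := by
  classical
  -- A default for variables that do not occur in `φ`.
  have z : S := ⟨Structure.funMap (Op.zero : (lang ι).Functions 0) Fin.elim0,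
    S.fun_mem _ _ fun i => i.elim0⟩
  let w : ℕ → S := fun x => if h : v x ∈ S then ⟨v x, h⟩ else z
  have hw := hS w
  rw [Formula.Realize, ← hφ.realize_embedding S.subtype] at hw
  rw [Formula.Realize, realize_congr hφ (w := S.subtype ∘ w)]
  · convert hw using 1
  · intro x hx
    simp [w, hv x hx]

end Logic

/-! ### The algebra with a split orbit. -/

section Algebra

variable (ι : Type u) (Y Y' C : Type)

/-- The permutations of `ι × Y` that permute the blocks `{i} × Y`. -/
def blockPerm : Subgroup (Equiv.Perm (ι × Y)) where
  carrier := {g | ∀ p q, (g p).1 = (g q).1 ↔ p.1 = q.1}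
  mul_mem' := fun ha hb p q => (ha _ _).trans (hb p q)
  one_mem' := fun _ _ => Iff.rfl
  inv_mem' := fun {a} ha p q => by
    rw [← ha]
    simp

/-- The base: points `(i, y)`, with coordinates in `ι × Y'`, together with labels, which are the
block permutations of `ι × Y`. -/
abbrev Base := (ι × Y') ⊕ blockPerm ι Y

variable {ι Y Y' C}

/-- The action of a block permutation on the base, by left translation on labels. -/
def act (g : blockPerm ι Y) : Base ι Y Y ≃ Base ι Y Y :=
  Equiv.sumCongr g.1 (Equiv.mulLeft g)

/-- The transversals: sequences of points meeting each block exactly once. -/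
def transv (ι : Type u) (Y Y' : Type) : Set (ι → Base ι Y Y') :=
  {s | ∃ (w : Equiv.Perm ι) (a : ι → Y'), ∀ i, s i = Sum.inl (w i, a i)}

theorem transv.trans {s s' : ι → Base ι Y Y} (hs : s ∈ transv ι Y Y) (hs' : s' ∈ transv ι Y Y) :
    ∃ g, act g ∘ s = s' := by
  classical
  obtain ⟨w, a, h⟩ := hs
  obtain ⟨w', a', h'⟩ := hs'
  -- Block `w i` goes to block `w' i`, and the fibre coordinates `a i` and `a' i` are exchanged on
  -- the way.
  let e : Equiv.Perm (ι × Y) :=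
    (Equiv.prodShear w⁻¹ fun i => Equiv.swap (a (w⁻¹ i)) (a' (w⁻¹ i))).trans
      (Equiv.prodCongr w' (Equiv.refl Y))
  refine ⟨⟨e, fun p q => by simp [e]⟩, ?_⟩
  funext i
  simp [act, h, h', e]

theorem transv.act_comp_mem (g : blockPerm ι Y) {s : ι → Base ι Y Y} (hs : s ∈ transv ι Y Y) :
    act g ∘ s ∈ transv ι Y Y := by
  obtain ⟨w, a, h⟩ := hs
  have hg := g.2
  have hg' : ∀ p q, (g.1 p).1 = (g.1 q).1 ↔ p.1 = q.1 := hg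
  let f : ι → ι := fun i => (g.1 (w i, a i)).1
  have hf : Bijective f := by
    constructor
    · intro i j hij
      exact w.injective ((hg' _ _).1 hij)
    · intro j
      obtain ⟨p, hp⟩ := g.1.surjective (j, a j)
      refine ⟨w.symm p.1, ?_⟩
      have : (g.1 (w (w.symm p.1), a (w.symm p.1))).1 = (g.1 p).1 := (hg' _ _).2 (by simp)
      simp only [f]
      rw [this, hp]
  exact ⟨Equiv.ofBijective f hf, fun i => (g.1 (w i, a i)).2, fun i => by simp [act, h, f]⟩

theorem transv.act_comp_mem_iff (g : blockPerm ι Y) {s : ι → Base ι Y Y} :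
    act g ∘ s ∈ transv ι Y Y ↔ s ∈ transv ι Y Y := by
  refine ⟨fun h => ?_, transv.act_comp_mem g⟩
  convert transv.act_comp_mem g⁻¹ h using 1
  funext i
  rcases h' : s i with p | p <;> simp [act, h']

theorem transv.injective {s : ι → Base ι Y Y'} (hs : s ∈ transv ι Y Y') : Injective s := by
  obtain ⟨w, a, h⟩ := hs
  intro i j hij
  rw [h, h] at hij
  simpa using congrArg Prod.fst (Sum.inl_injective hij)

open Classical in
theorem transv.comp_update_notMem {i j : ι} (hij : i ≠ j) (s : ι → Base ι Y Y') :
    s ∘ update id i j ∉ transv ι Y Y' := fun h => hij <| transv.injective h <| by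
  simp [update_of_ne hij.symm]

theorem transv.comp_equiv_mem (e : Equiv.Perm ι) {s : ι → Base ι Y Y'}
    (hs : s ∈ transv ι Y Y') : s ∘ e ∈ transv ι Y Y' := by
  obtain ⟨w, a, h⟩ := hs
  exact ⟨e.trans w, a ∘ e, fun i => by simp [h]⟩

theorem transv.comp_equiv_mem_iff (e : Equiv.Perm ι) {s : ι → Base ι Y Y'} :
    s ∘ e ∈ transv ι Y Y' ↔ s ∈ transv ι Y Y' := by
  refine ⟨fun h => ?_, transv.comp_equiv_mem e⟩
  convert transv.comp_equiv_mem e.symm h using 1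
  funext i
  simp

/-- A set of coloured sequences is admissible if it is invariant under block permutations and only
sees the colours of transversals. -/
structure Adm (Z : Set ((ι → Base ι Y Y) × C)) : Prop where
  act_iff : ∀ (g : blockPerm ι Y) (s : ι → Base ι Y Y) (c : C), (act g ∘ s, c) ∈ Z ↔ (s, c) ∈ Z
  color : ∀ (s : ι → Base ι Y Y) (c c' : C), s ∉ transv ι Y Y → (s, c) ∈ Z → (s, c') ∈ Z

theorem Adm.of_transv {Z : Set ((ι → Base ι Y Y) × C)} (hZ : Adm Z) {s s' : ι → Base ι Y Y} {c : C}
    (hs : s ∈ transv ι Y Y) (hs' : s' ∈ transv ι Y Y) (h : (s, c) ∈ Z) : (s', c) ∈ Z := by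
  obtain ⟨g, rfl⟩ := transv.trans hs hs'
  exact (hZ.act_iff g s c).2 h

open Classical in
/-- The operations on sets of coloured sequences: cylindrifications forget the colour, the other
operations preserve it. -/
def colOp {V : Type u} : {n : ℕ} → Op ι n → (Fin n → Set ((ι → V) × C)) → Set ((ι → V) × C)
  | _, .zero, _ => ∅
  | _, .one, _ => Set.univ
  | _, .diag i j, _ => {p | p.1 i = p.1 j}
  | _, .compl, X => (X 0)ᶜ
  | _, .cyl i, X => {p | ∃ (a : V) (c : C), (update p.1 i a, c) ∈ X 0}
  | _, .repl i j, X => {p | (p.1 ∘ update id i j, p.2) ∈ X 0}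
  | _, .swap i j, X => {p | (p.1 ∘ Equiv.swap i j, p.2) ∈ X 0}
  | _, .sup, X => X 0 ∪ X 1
  | _, .inf, X => X 0 ∩ X 1

-- Cylindrifications forget the colour, transpositions preserve transversals, and a proper
-- replacement repeats an entry, so its result is never a transversal.
open Classical in
theorem Adm.colOp : ∀ {n : ℕ} (f : Op ι n) {X : Fin n → Set ((ι → Base ι Y Y) × C)},
    (∀ i, Adm (X i)) → Adm (colOp f X)
  | _, .zero, _, _ => ⟨fun _ _ _ => Iff.rfl, fun _ _ _ _ h => h⟩
  | _, .one, _, _ => ⟨fun _ _ _ => Iff.rfl, fun _ _ _ _ h => h⟩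
  | _, .diag i j, _, _ => ⟨fun g _ _ => (act g).injective.eq_iff, fun _ _ _ _ h => h⟩
  | _, .compl, X, hX => ⟨fun g s c => not_congr ((hX 0).act_iff g s c),
      fun s c c' hs h h' => h ((hX 0).color s c' c hs h')⟩
  | _, .cyl i, X, hX => by
    refine ⟨fun g s c => ?_, fun _ _ _ _ h => h⟩
    constructor
    · rintro ⟨a, c', h⟩
      refine ⟨(act g).symm a, c', ?_⟩
      rw [← (hX 0).act_iff g, comp_update]
      simpa using h
    · rintro ⟨a, c', h⟩
      refine ⟨act g a, c', ?_⟩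
      rw [← (hX 0).act_iff g, comp_update] at h
      exact h
  | _, .repl i j, X, hX => by
    refine ⟨fun g s c => (hX 0).act_iff g _ c, fun s c c' hs h => ?_⟩
    by_cases hij : i = j
    · subst hij
      have : update (id : ι → ι) i i = id := update_eq_self i _
      simp only [QEA.colOp, this, Set.mem_ofPred_eq, comp_id] at h ⊢
      exact (hX 0).color s c c' hs h
    · exact (hX 0).color _ c c' (transv.comp_update_notMem hij s) h
  | _, .swap i j, X, hX => ⟨fun g s c => (hX 0).act_iff g _ c, fun s c c' hs h =>
      (hX 0).color _ c c' (by rwa [transv.comp_equiv_mem_iff]) h⟩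
  | _, .sup, X, hX => ⟨fun g s c => or_congr ((hX 0).act_iff g s c) ((hX 1).act_iff g s c),
      fun s c c' hs => Or.imp ((hX 0).color s c c' hs) ((hX 1).color s c c' hs)⟩
  | _, .inf, X, hX => ⟨fun g s c => and_congr ((hX 0).act_iff g s c) ((hX 1).act_iff g s c),
      fun s c c' hs => And.imp ((hX 0).color s c c' hs) ((hX 1).color s c c' hs)⟩

variable (ι Y C) in
/-- The algebra of admissible sets of coloured sequences. -/
def ColAlg : Type u := {Z : Set ((ι → Base ι Y Y) × C) // Adm Z}

instance : (lang ι).Structure (ColAlg ι Y C) where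
  funMap := fun f X => ⟨colOp f fun i => (X i).1, Adm.colOp f fun i => (X i).2⟩
  RelMap := fun r _ => r.elim

/-- A set of coloured sequences is saturated if it does not separate colours with the same value
of `ρ`. -/
def Sat {V D : Type*} (ρ : C → D) (Z : Set ((ι → V) × C)) : Prop :=
  ∀ s c c', ρ c = ρ c' → (s, c) ∈ Z → (s, c') ∈ Z

theorem Sat.colOp {V : Type u} {D : Type*} {ρ : C → D} :
    ∀ {n : ℕ} (f : Op ι n) {X : Fin n → Set ((ι → V) × C)},
    (∀ i, Sat ρ (X i)) → Sat ρ (colOp f X)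
  | _, .zero, _, _ => fun _ _ _ _ h => h
  | _, .one, _, _ => fun _ _ _ _ h => h
  | _, .diag _ _, _, _ => fun _ _ _ _ h => h
  | _, .compl, _, hX => fun s c c' hc h h' => h (hX 0 s c' c hc.symm h')
  | _, .cyl _, _, _ => fun _ _ _ _ h => h
  | _, .repl _ _, _, hX => fun _ c c' hc h => hX 0 _ c c' hc h
  | _, .swap _ _, _, hX => fun _ c c' hc h => hX 0 _ c c' hc h
  | _, .sup, _, hX => fun s c c' hc => Or.imp (hX 0 s c c' hc) (hX 1 s c c' hc)
  | _, .inf, _, hX => fun s c c' hc => And.imp (hX 0 s c c' hc) (hX 1 s c c' hc)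

/-- The subalgebra of saturated elements. -/
def satSub {D : Type*} (ρ : C → D) : (lang ι).Substructure (ColAlg ι Y C) where
  carrier := {Z | Sat ρ Z.1}
  fun_mem := fun f _ hX => Sat.colOp f hX

end Algebra

/-! ### Sums over infinitely many coordinates. -/

section Coloring

/-- There is a function on sequences in an abelian group that behaves like the sum of all entries
under changes of a single entry. -/
theorem exists_sum (ι : Type u) (Y : Type) [AddCommGroup Y] [DecidableEq ι] :
    ∃ σ : (ι → Y) → Y, ∀ (b : ι → Y) (j : ι) (y : Y), σ (update b j y) = σ b + (y - b j) := by
  -- Fix a representative of each class modulo finite changes; `σ` sums the finitely many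
  -- differences from it.
  let rep : (ι → Y) → (ι → Y) := fun b =>
    (Quotient.mk (Filter.germSetoid Filter.cofinite Y) b).out
  have hrep : ∀ b, rep b =ᶠ[Filter.cofinite] b := fun b =>
    Quotient.mk_out (s := Filter.germSetoid Filter.cofinite Y) b
  have hfin : ∀ b, (support fun i => b i - rep b i).Finite := fun b => by
    refine Set.Finite.subset (hrep b) fun i hi => ?_
    intro h
    exact hi (by simpa [sub_eq_zero] using h.symm)
  refine ⟨fun b => ∑ᶠ i, (b i - rep b i), fun b j y => ?_⟩
  have hupd : rep (update b j y) = rep b := by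
    have : Quotient.mk (Filter.germSetoid Filter.cofinite Y) (update b j y) =
        Quotient.mk (Filter.germSetoid Filter.cofinite Y) b := by
      refine Quotient.sound ?_
      refine Set.Finite.subset (Set.finite_singleton j) fun i hi => ?_
      by_contra h
      exact hi (update_of_ne h _ _)
    simp only [rep, this]
  have h := finsum_sub_distrib (hfin (update b j y)) (hfin b)
  rw [hupd] at h
  have h' : ∑ᶠ i, (update b j y i - rep b i - (b i - rep b i)) = y - b j := by
    rw [finsum_eq_single _ j fun i hi => by simp [hi], update_self]
    abel
  rw [h'] at h
  simp only [hupd]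
  rw [h, add_sub_cancel]

end Coloring

/-! ### Representations from full colourings. -/

section Represent

variable {ι : Type u} {Y Y' C D : Type}

/-- The change of points along a map `p : Y' → Y`. -/
def baseMap (p : Y' → Y) : Base ι Y Y' → Base ι Y Y :=
  Sum.map (Prod.map id p) id

theorem baseMap_surjective {p : Y' → Y} (hp : Surjective p) :
    Surjective (baseMap (ι := ι) p) :=
  Surjective.sumMap (surjective_id.prodMap hp) surjective_id

theorem baseMap_injective {p : Y' → Y} (hp : Injective p) :
    Injective (baseMap (ι := ι) p) :=
  Injective.sumMap (injective_id.prodMap hp) injective_id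

theorem baseMap_comp_mem {p : Y' → Y} {s : ι → Base ι Y Y'} :
    baseMap p ∘ s ∈ transv ι Y Y ↔ s ∈ transv ι Y Y' := by
  constructor
  · rintro ⟨w, a, h⟩
    have : ∀ i, ∃ y, s i = Sum.inl (w i, y) := by
      intro i
      have := h i
      rcases hs : s i with ⟨j, y⟩ | g
      · simp only [comp_apply, hs, baseMap, Sum.map_inl, Sum.inl.injEq, Prod.map, id,
          Prod.mk.injEq] at this
        exact ⟨y, by rw [this.1]⟩
      · simp [hs, baseMap] at this
    choose b hb using this
    exact ⟨w, b, hb⟩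
  · rintro ⟨w, a, h⟩
    exact ⟨w, p ∘ a, fun i => by simp [h, baseMap]⟩

open Classical in
/-- The second coordinates of the points in a set, listed by blocks. -/
noncomputable def blockVal [Nonempty Y'] (S : Set (Base ι Y Y')) (j : ι) : Y' :=
  if h : ∃ y, Sum.inl (j, y) ∈ S then h.choose else Classical.arbitrary Y'

theorem blockVal_range [Nonempty Y'] {s : ι → Base ι Y Y'} {w : Equiv.Perm ι} {a : ι → Y'}
    (h : ∀ i, s i = Sum.inl (w i, a i)) (i : ι) : blockVal (Set.range s) (w i) = a i := by
  have hex : ∃ y, (Sum.inl (w i, y) : Base ι Y Y') ∈ Set.range s := ⟨a i, i, h i⟩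
  rw [blockVal, dif_pos hex]
  obtain ⟨k, hk⟩ := hex.choose_spec
  rw [h, Sum.inl.injEq, Prod.mk.injEq] at hk
  rw [← hk.2, w.injective hk.1]

open Classical in
theorem transv.update_mem {s : ι → Base ι Y Y'} {i : ι} {w : Equiv.Perm ι} {a : ι → Y'}
    (h : ∀ i, s i = Sum.inl (w i, a i)) (y : Y') (k : ι) :
    update s i (Sum.inl (w i, y)) k = Sum.inl (w k, update a i y k) := by
  rcases eq_or_ne k i with rfl | hk <;> simp [*]

open Classical in
theorem blockVal_range_update [Nonempty Y'] {s : ι → Base ι Y Y'} {i : ι} {w : Equiv.Perm ι}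
    {a : ι → Y'} (h : ∀ i, s i = Sum.inl (w i, a i)) (y : Y') :
    blockVal (Set.range (update s i (Sum.inl (w i, y)))) =
      update (blockVal (Set.range s)) (w i) y := by
  funext j
  obtain ⟨k, rfl⟩ := w.surjective j
  rw [blockVal_range (transv.update_mem h y)]
  rcases eq_or_ne k i with rfl | hk
  · simp
  · rw [update_of_ne hk, update_of_ne (w.injective.ne hk), blockVal_range h]

/-- The coloured sequence below a sequence, for a colouring `χ` of sequences in `Y'`. -/
noncomputable def colSeq [Nonempty Y'] (p : Y' → Y) (χ : (ι → Y') → C) (s : ι → Base ι Y Y') :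
    (ι → Base ι Y Y) × C :=
  (baseMap p ∘ s, χ (blockVal (Set.range s)))

open Classical in
/-- A colouring is `ρ`-full if every value of `ρ` is attained on each line. -/
def IsFull (ρ : C → D) (χ : (ι → Y') → C) : Prop :=
  ∀ (b : ι → Y') (j : ι) (c : C), ∃ y, ρ (χ (update b j y)) = ρ c

variable [Nonempty Y'] {p : Y' → Y} {χ : (ι → Y') → C} {ρ : C → D}

-- This is the hard half of preserving cylindrifications. If the changed sequence is a transversal,
-- fullness moves the new entry within its block to a colour equivalent to `c`; the orbit stays the
-- same, so admissibility and saturation apply. Otherwise the colour is irrelevant.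
open Classical in
theorem exists_colSeq_update_mem (hp : Surjective p) (hχ : IsFull ρ χ)
    {Z : Set ((ι → Base ι Y Y) × C)} (hZ : Adm Z) (hs : Sat ρ Z) {s : ι → Base ι Y Y'} {i : ι}
    {a : Base ι Y Y} {c : C} (h : (update (baseMap p ∘ s) i a, c) ∈ Z) :
    ∃ a', colSeq p χ (update s i a') ∈ Z := by
  obtain ⟨a₀, rfl⟩ := baseMap_surjective hp a
  rw [← comp_update] at h
  by_cases hR : update s i a₀ ∈ transv ι Y Y'
  · obtain ⟨w, e, he⟩ := hR
    obtain ⟨y, hy⟩ := hχ (blockVal (Set.range (update s i a₀))) (w i) c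
    have hu := transv.update_mem (i := i) he y
    have hv := blockVal_range_update (i := i) he y
    simp only [update_idem] at hu hv
    refine ⟨Sum.inl (w i, y), ?_⟩
    rw [← hv] at hy
    refine hs _ _ _ hy.symm (hZ.of_transv ?_ ?_ h)
    · exact baseMap_comp_mem.2 ⟨w, e, he⟩
    · exact baseMap_comp_mem.2 ⟨w, _, hu⟩
  · exact ⟨a₀, hZ.color _ _ _ (by rwa [baseMap_comp_mem]) h⟩

open Classical in
theorem preimage_colSeq_colOp (hp : Surjective p) (hχ : IsFull ρ χ) : ∀ {n : ℕ} (f : Op ι n),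
    (¬ f.IsDiag ∨ Injective p) → ∀ {X : Fin n → Set ((ι → Base ι Y Y) × C)},
    (∀ i, Adm (X i)) → (∀ i, Sat ρ (X i)) →
      colSeq p χ ⁻¹' colOp f X = setOp f fun i => colSeq p χ ⁻¹' X i
  | _, .zero, _, _, _, _ => rfl
  | _, .one, _, _, _, _ => rfl
  | _, .diag i j, h, _, _, _ => by
    have hp' := baseMap_injective (ι := ι) (h.resolve_left fun h => h trivial)
    ext s
    exact hp'.eq_iff
  | _, .compl, _, _, _, _ => rfl
  | _, .cyl i, _, X, hX, hs => by
    ext s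
    constructor
    · rintro ⟨a, c, h⟩
      exact exists_colSeq_update_mem hp hχ (hX 0) (hs 0) h
    · rintro ⟨a, h⟩
      refine ⟨baseMap p a, χ (blockVal (Set.range (update s i a))), ?_⟩
      change (update (baseMap p ∘ s) i (baseMap p a), _) ∈ X 0
      rw [← comp_update]
      exact h
  | _, .repl i j, _, X, hX, hs => by
    classical
    by_cases hij : i = j
    · subst hij
      have : update (id : ι → ι) i i = id := update_eq_self i _
      ext s
      simp only [colOp, setOp, this, Set.mem_ofPred_eq, comp_id, Set.mem_preimage]
    · ext s
      have hn := transv.comp_update_notMem hij (baseMap p ∘ s)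
      exact ⟨(hX 0).color _ _ _ hn, (hX 0).color _ _ _ hn⟩
  | _, .swap i j, _, X, hX, hs => by
    classical
    ext s
    -- The colour depends only on the range, so transpositions keep it.
    have : Set.range (s ∘ Equiv.swap i j) = Set.range s := (Equiv.swap i j).surjective.range_comp s
    simp only [colOp, setOp, Set.mem_ofPred_eq, Set.mem_preimage, colSeq, this]
    rfl
  | _, .sup, _, _, _, _ => rfl
  | _, .inf, _, _, _, _ => rfl

/-- A point of the difference `Z ∩ Z'ᶜ`, itself admissible and saturated, can be changed in one
entry to one that lifts along `colSeq`. -/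
theorem preimage_colSeq_subset [Nonempty ι] (hp : Surjective p) (hχ : IsFull ρ χ)
    {Z Z' : Set ((ι → Base ι Y Y) × C)} (hZ : Adm Z) (hZ' : Adm Z') (hs : Sat ρ Z) (hs' : Sat ρ Z')
    (h : colSeq p χ ⁻¹' Z ⊆ colSeq p χ ⁻¹' Z') : Z ⊆ Z' := by
  classical
  rintro ⟨s, c⟩ hsZ
  by_contra hsZ'
  have hA : Adm (Z ∩ Z'ᶜ) :=
    Adm.colOp (.inf : Op ι 2) (X := ![Z, Z'ᶜ]) fun i => by
      fin_cases i
      exacts [hZ, Adm.colOp (.compl : Op ι 1) (X := ![Z']) fun i => by simpa using hZ']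
  have hS : Sat ρ (Z ∩ Z'ᶜ) := fun s c c' hc hh => ⟨hs s c c' hc hh.1,
    fun h' => hh.2 (hs' s c' c hc.symm h')⟩
  obtain ⟨i⟩ := ‹Nonempty ι›
  obtain ⟨s', rfl⟩ := (baseMap_surjective (ι := ι) hp).comp_left s
  obtain ⟨a, ha⟩ := exists_colSeq_update_mem hp hχ hA hS (s := s') (i := i)
    (a := (baseMap p ∘ s') i) (c := c) (by rw [update_eq_self]; exact ⟨hsZ, hsZ'⟩)
  exact ha.2 (h ha.1)

theorem preimage_colSeq_injective [Nonempty ι] (hp : Surjective p) (hχ : IsFull ρ χ)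
    {Z Z' : Set ((ι → Base ι Y Y) × C)} (hZ : Adm Z) (hZ' : Adm Z') (hs : Sat ρ Z) (hs' : Sat ρ Z')
    (h : colSeq p χ ⁻¹' Z = colSeq p χ ⁻¹' Z') : Z = Z' :=
  (preimage_colSeq_subset hp hχ hZ hZ' hs hs' h.subset).antisymm
    (preimage_colSeq_subset hp hχ hZ' hZ hs' hs h.superset)

/-- The algebra of saturated elements is representable if there is a full colouring of the
sequences in `Y`. -/
theorem isRepresentable_satSub [Nonempty ι] [Nonempty Y] {χ : (ι → Y) → C} {ρ : C → D}
    (hχ : IsFull ρ χ) : IsRepresentable ι (satSub (ι := ι) (Y := Y) ρ) :=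
  ⟨PUnit, fun _ => Base ι Y Y, fun Z _ => colSeq id χ ⁻¹' Z.1.1,
    fun Z Z' h => Subtype.ext <| Subtype.ext <| preimage_colSeq_injective surjective_id hχ Z.1.2
      Z'.1.2 Z.2 Z'.2 (congrFun h PUnit.unit),
    fun _ f x _ => preimage_colSeq_colOp surjective_id hχ f (Or.inr injective_id)
      (fun i => (x i).1.2) fun i => (x i).2⟩

/-- The diagonal-free reduct of the algebra of coloured sequences is representable if there is a
full colouring of the sequences in some `Y'` mapping onto `Y`. -/
theorem isDiagFreeRepresentable_colAlg [Nonempty ι] (hp : Surjective p)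
    (hχ : IsFull (id : C → C) χ) : IsDiagFreeRepresentable ι (ColAlg ι Y C) := by
  have hs : ∀ Z : Set ((ι → Base ι Y Y) × C), Sat (id : C → C) Z := by
    rintro Z s c _ rfl h
    exact h
  exact ⟨PUnit, fun _ => Base ι Y Y', fun Z _ => colSeq p χ ⁻¹' Z.1,
    fun Z Z' h => Subtype.ext <| preimage_colSeq_injective hp hχ Z.2 Z'.2 (hs _) (hs _)
      (congrFun h PUnit.unit),
    fun _ f hf x _ => preimage_colSeq_colOp hp hχ f (Or.inl hf) (fun i => (x i).2) fun i => hs _⟩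

end Represent

/-! ### Calculus in a hypothetical representation. -/

section Hom

variable {ι T : Type u} {Y C : Type} {H : ColAlg ι Y C → Set (ι → T)}

/-- `H` preserves all operations. -/
def IsHom (H : ColAlg ι Y C → Set (ι → T)) : Prop :=
  ∀ (n : ℕ) (f : Op ι n) (x : Fin n → ColAlg ι Y C),
    H (Structure.funMap (L := lang ι) f x) = setOp f fun i => H (x i)

/-- Inclusion is an equation, so facts about an unknown representation reduce to inclusions between
sets of coloured sequences. -/
theorem IsHom.mono (hH : IsHom H) {Z Z' : ColAlg ι Y C} (h : Z.1 ⊆ Z'.1) : H Z ⊆ H Z' := by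
  have h1 : Structure.funMap (L := lang ι) (Op.inf : Op ι 2) ![Z, Z'] = Z :=
    Subtype.ext (Set.inter_eq_left.2 h)
  have h2 := hH 2 .inf ![Z, Z']
  rw [h1] at h2
  exact h2.subset.trans Set.inter_subset_right

theorem IsHom.not_mem (hH : IsHom H) {Z : ColAlg ι Y C} (h : Z.1 ⊆ ∅) (t : ι → T) : t ∉ H Z := by
  have h1 : Structure.funMap (L := lang ι) (Op.zero : Op ι 0) ![] = Z :=
    Subtype.ext (Set.subset_empty_iff.1 h).symm
  have h2 := hH 0 .zero ![]
  rw [h1] at h2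
  rw [h2]
  exact Set.notMem_empty t

theorem IsHom.mem_inf (hH : IsHom H) {Z₁ Z₂ : ColAlg ι Y C} {t : ι → T} (h₁ : t ∈ H Z₁)
    (h₂ : t ∈ H Z₂) : t ∈ H (Structure.funMap (L := lang ι) (Op.inf : Op ι 2) ![Z₁, Z₂]) := by
  rw [hH]
  exact ⟨h₁, h₂⟩

theorem IsHom.disjoint (hH : IsHom H) {Z₁ Z₂ : ColAlg ι Y C} {t : ι → T} (h₁ : t ∈ H Z₁)
    (h₂ : t ∈ H Z₂) : ¬ Z₁.1 ∩ Z₂.1 ⊆ ∅ := fun h =>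
  hH.not_mem (Z := Structure.funMap (L := lang ι) (Op.inf : Op ι 2) ![Z₁, Z₂]) h t
    (hH.mem_inf h₁ h₂)

theorem IsHom.mem_sup (hH : IsHom H) {Z₁ Z₂ Z : ColAlg ι Y C} {t : ι → T} (ht : t ∈ H Z)
    (h : Z.1 ⊆ Z₁.1 ∪ Z₂.1) : t ∈ H Z₁ ∨ t ∈ H Z₂ := by
  have := hH.mono (Z' := Structure.funMap (L := lang ι) (Op.sup : Op ι 2) ![Z₁, Z₂]) h ht
  rw [hH] at this
  exact this

theorem IsHom.mem_compl (hH : IsHom H) {Z : ColAlg ι Y C} {t : ι → T} (ht : t ∉ H Z) :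
    t ∈ H (Structure.funMap (L := lang ι) (Op.compl : Op ι 1) ![Z]) := by
  rw [hH]
  exact ht

/-- Only finite unions are preserved; this is where finiteness of the blocks enters. -/
theorem IsHom.exists_mem_of_finite (hH : IsHom H) {β : Type*} [Finite β] (Zf : β → ColAlg ι Y C)
    {Z : ColAlg ι Y C} {t : ι → T} (ht : t ∈ H Z) (h : Z.1 ⊆ ⋃ y, (Zf y).1) :
    ∃ y, t ∈ H (Zf y) := by
  classical
  cases nonempty_fintype β
  have key : ∀ (s : Finset β) (Z : ColAlg ι Y C), t ∈ H Z → (Z.1 ⊆ ⋃ y ∈ s, (Zf y).1) →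
      ∃ y, t ∈ H (Zf y) := by
    intro s
    induction s using Finset.induction_on with
    | empty => exact fun Z ht h => absurd ht (hH.not_mem (by simpa using h) t)
    | insert a s _ ih =>
      intro Z ht h
      by_cases hta : t ∈ H (Zf a)
      · exact ⟨a, hta⟩
      · refine ih (Structure.funMap (L := lang ι) (Op.inf : Op ι 2)
          ![Z, Structure.funMap (L := lang ι) (Op.compl : Op ι 1) ![Zf a] ])
          (hH.mem_inf ht (hH.mem_compl hta)) ?_
        rintro q ⟨hq, hqa⟩
        have := h hq
        rw [Finset.set_biUnion_insert] at this
        exact this.resolve_left hqa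
  exact key Finset.univ Z ht (by simpa using h)

open Classical in
theorem IsHom.exists_update_mem (hH : IsHom H) {Z Z' : ColAlg ι Y C} {t : ι → T} {i : ι}
    (ht : t ∈ H Z') (h : ∀ q ∈ Z'.1, ∃ a c, (update q.1 i a, c) ∈ Z.1) :
    ∃ a, update t i a ∈ H Z := by
  have := hH.mono (Z' := Structure.funMap (L := lang ι) (Op.cyl i : Op ι 1) ![Z]) h ht
  rw [hH] at this
  exact this

open Classical in
theorem IsHom.mem_cyl (hH : IsHom H) {Z : ColAlg ι Y C} {t : ι → T} {i : ι} {a : T}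
    (ht : update t i a ∈ H Z) :
    t ∈ H (Structure.funMap (L := lang ι) (Op.cyl i : Op ι 1) ![Z]) := by
  rw [hH]
  exact ⟨a, ht⟩

open Classical in
theorem IsHom.update_mem (hH : IsHom H) {Z : ColAlg ι Y C} {t : ι → T} {i : ι} (a : T)
    (ht : t ∈ H Z) (h : ∀ s x c c', (update s i x, c) ∈ Z.1 → (s, c') ∈ Z.1) :
    update t i a ∈ H Z := by
  have h1 : update (update t i a) i (t i) ∈ H Z := by simpa using ht
  refine hH.mono ?_ (hH.mem_cyl h1)
  rintro ⟨s, c'⟩ ⟨x, c, hx⟩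
  exact h s x c c' hx

open Classical in
theorem IsHom.mem_swap (hH : IsHom H) {Z : ColAlg ι Y C} {t : ι → T} {i j : ι}
    (ht : t ∘ Equiv.swap i j ∈ H Z) :
    t ∈ H (Structure.funMap (L := lang ι) (Op.swap i j : Op ι 1) ![Z]) := by
  rw [hH]
  exact ht

open Classical in
theorem IsHom.comp_repl_mem (hH : IsHom H) {Z Z' : ColAlg ι Y C} {t : ι → T} {i j : ι}
    (ht : t ∈ H Z') (h : ∀ s c, (s, c) ∈ Z'.1 → (s ∘ update id i j, c) ∈ Z.1) :
    t ∘ update id i j ∈ H Z := by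
  have := hH.mono (Z' := Structure.funMap (L := lang ι) (Op.repl i j : Op ι 1) ![Z])
    (fun q hq => h q.1 q.2 hq) ht
  rw [hH] at this
  exact this

theorem IsHom.apply_eq (hH : IsHom H) {Z : ColAlg ι Y C} {t : ι → T} {i j : ι}
    (ht : t ∈ H Z) (h : ∀ q ∈ Z.1, q.1 i = q.1 j) : t i = t j := by
  have := hH.mono (Z' := Structure.funMap (L := lang ι) (Op.diag i j : Op ι 0) ![]) h ht
  rw [hH] at this
  exact this

end Hom

/-! ### Nonrepresentability by pigeonhole. -/

section Nonrepresentable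

variable {ι : Type u} {Y C : Type}

/-- An invariant set of sequences as an element of the algebra. -/
def ofSet (S : Set (ι → Base ι Y Y)) (h : ∀ g s, s ∈ S → act g ∘ s ∈ S) : ColAlg ι Y C :=
  ⟨{q | q.1 ∈ S}, fun g s c => by
    refine ⟨fun hs => ?_, h g s⟩
    have := h g⁻¹ _ hs
    have hg : act g⁻¹ ∘ act g ∘ s = s := by
      funext i
      rcases h' : s i with p | p <;> simp [act, h']
    rwa [hg] at this, fun _ _ _ _ hs => hs⟩

/-- The transversals of colour `c`. -/
def colorClass (c : C) : ColAlg ι Y C :=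
  ⟨{q | q.1 ∈ transv ι Y Y ∧ q.2 = c},
    fun _ _ _ => and_congr (transv.act_comp_mem_iff _) Iff.rfl, fun _ _ _ hs h => absurd h.1 hs⟩

/-- The sequences with a label at `i₀` whose other entries lie in the blocks listed by the
label. -/
def labelled (i₀ : ι) : ColAlg ι Y C :=
  ofSet {s | ∃ v : blockPerm ι Y, s i₀ = Sum.inr v ∧ ∀ i ≠ i₀, ∃ y, s i = Sum.inl (v.1 (i, y))} <| by
    rintro g s ⟨v, hv, h⟩
    refine ⟨g * v, by simp [act, hv], fun i hi => ?_⟩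
    obtain ⟨y, hy⟩ := h i hi
    exact ⟨y, by simp [act, hy]⟩

/-- The sequences with a label at `a` and, at `b`, the image of some `(j, y)`, with `y` in `P`,
under this label. -/
def listed (j : ι) (P : Set Y) (a b : ι) : ColAlg ι Y C :=
  ofSet {s | ∃ v : blockPerm ι Y, s a = Sum.inr v ∧ ∃ y ∈ P, s b = Sum.inl (v.1 (j, y))} <| by
    rintro g s ⟨v, hv, y, hy, h⟩
    exact ⟨g * v, by simp [act, hv], y, hy, by simp [act, h]⟩

theorem mem_listed {j : ι} {P : Set Y} {a b : ι} {q : (ι → Base ι Y Y) × C} :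
    q ∈ (listed (C := C) j P a b).1 ↔
      ∃ v : blockPerm ι Y, q.1 a = Sum.inr v ∧ ∃ y ∈ P, q.1 b = Sum.inl (v.1 (j, y)) :=
  Iff.rfl

open Classical in
theorem listed_of_update {j : ι} {P : Set Y} {a b k : ι} (ha : a ≠ k) (hb : b ≠ k)
    (s : ι → Base ι Y Y) (x : Base ι Y Y) (c c' : C)
    (h : (update s k x, c) ∈ (listed (C := C) j P a b).1) : (s, c') ∈ (listed j P a b).1 := by
  simpa [mem_listed, ha, hb] using h

theorem listed_disjoint {j j' : ι} (hj : j ≠ j') {P P' : Set Y} {a b : ι} :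
    (listed (C := C) j P a b).1 ∩ (listed j' P' a b).1 ⊆ ∅ := by
  rintro q ⟨⟨v, hv, y, -, hy⟩, v', hv', y', -, hy'⟩
  rw [hv, Sum.inr.injEq] at hv'
  subst hv'
  rw [hy, Sum.inl.injEq] at hy'
  exact hj (congrArg Prod.fst (v.1.injective hy'))

open Classical in
theorem transv.exists_labelled {s : ι → Base ι Y Y} (hs : s ∈ transv ι Y Y) (i₀ : ι) :
    ∃ v : blockPerm ι Y, ∀ c : C, (update s i₀ (Sum.inr v), c) ∈ (labelled (C := C) i₀).1 := by
  obtain ⟨w, a, h⟩ := hs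
  obtain ⟨g, hg⟩ := transv.trans (ι := ι) (s := fun i => Sum.inl (i, a i)) (s' := s)
    ⟨1, a, fun _ => rfl⟩ ⟨w, a, h⟩
  refine ⟨g, fun c => ⟨g, by simp, fun i hi => ⟨a i, ?_⟩⟩⟩
  simp only [update_of_ne hi, ← hg]
  rfl

open Classical in
/-- If `s` extends to a transversal at `b` and the label `s b` lists the blocks of the entries of
`s` other than `s i₀` and `s b`, then `s i₀` is in one of the two remaining blocks of the list. -/
theorem listed_of_transv_of_labelled {i₀ b : ι} (hb : b ≠ i₀) {s : ι → Base ι Y Y} (c : C)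
    (h₁ : ∃ a, update s b a ∈ transv ι Y Y)
    (h₂ : ∃ a c', (update (s ∘ Equiv.swap i₀ b) b a, c') ∈ (labelled (C := C) i₀).1) :
    (s, c) ∈ (listed i₀ Set.univ b i₀).1 ∪ (listed (C := C) b Set.univ b i₀).1 := by
  obtain ⟨a, w, e, h⟩ := h₁
  obtain ⟨a', c', v, hv, hv'⟩ := h₂
  have hvG : ∀ p q, (v.1 p).1 = (v.1 q).1 ↔ p.1 = q.1 := v.2
  simp only [update_of_ne hb.symm, comp_apply, Equiv.swap_apply_left] at hv
  have h0 : s i₀ = Sum.inl (w i₀, e i₀) := by simpa [hb.symm] using h i₀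
  obtain ⟨⟨j, y⟩, hjy⟩ := v.1.surjective (w i₀, e i₀)
  have hj : j = i₀ ∨ j = b := by
    by_contra! hj
    have h1 := h j
    obtain ⟨y', h2⟩ := hv' j hj.1
    simp only [update_of_ne hj.2, comp_apply, Equiv.swap_apply_of_ne_of_ne hj.1 hj.2] at h1 h2
    rw [h1, Sum.inl.injEq] at h2
    have h3 := (hvG (j, y') (j, y)).2 rfl
    rw [← h2, hjy] at h3
    exact hj.1 (w.injective h3)
  rcases hj with rfl | rfl
  · exact Or.inl ⟨v, hv, y, trivial, by rw [hjy]; exact h0⟩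
  · exact Or.inr ⟨v, hv, y, trivial, by rw [hjy]; exact h0⟩

open Classical in
/-- The algebra of coloured sequences is not representable if there are more colours than points in
a block. -/
theorem not_isRepresentable_colAlg [Fintype Y] [Nonempty Y] [Fintype C]
    (hcard : Fintype.card Y < Fintype.card C) {i₀ i₁ i₂ : ι} (h01 : i₀ ≠ i₁) (h02 : i₀ ≠ i₂)
    (h12 : i₁ ≠ i₂) : ¬ IsRepresentable ι (ColAlg ι Y C) := by
  rintro ⟨J, U, h, hinj, hh⟩
  obtain ⟨c₀⟩ : Nonempty C := Fintype.card_pos_iff.1 (by lia)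
  let y₀ : Y := Classical.arbitrary Y
  have hne : (colorClass c₀ : ColAlg ι Y C) ≠
      Structure.funMap (L := lang ι) (Op.zero : Op ι 0) ![] := by
    intro he
    have : ((fun i => Sum.inl (i, y₀), c₀) : (ι → Base ι Y Y) × C) ∈
        (colorClass c₀ : ColAlg ι Y C).1 := ⟨⟨1, fun _ => y₀, fun _ => rfl⟩, rfl⟩
    rw [he] at this
    exact this
  obtain ⟨j, hj⟩ := Function.ne_iff.1 (hinj.ne hne)
  obtain ⟨H, hH, hj⟩ : ∃ H : ColAlg ι Y C → Set (ι → U j), IsHom H ∧ H (colorClass c₀) ≠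
      H (Structure.funMap (L := lang ι) (Op.zero : Op ι 0) ![]) :=
    ⟨fun Z => h Z j, fun n f x => hh n f x j, hj⟩
  rw [hH] at hj
  obtain ⟨t, ht⟩ := Set.nonempty_iff_ne_empty.2 hj
  have hx : ∀ c, ∃ x, update t i₀ x ∈ H (colorClass c) := fun c =>
    hH.exists_update_mem ht fun q hq => ⟨q.1 i₀, c, by rw [update_eq_self]; exact ⟨hq.1, rfl⟩⟩
  choose x hx using hx
  obtain ⟨v, hv⟩ : ∃ v, update t i₀ v ∈ H (labelled i₀) :=
    hH.exists_update_mem ht fun q hq =>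
      let ⟨v, hv⟩ := transv.exists_labelled hq.1 i₀
      ⟨_, c₀, hv c₀⟩
  -- Put the label `v` at `b`. Restoring entry `b` gives a transversal; moving `v` back to `i₀`
  -- gives a labelled sequence. So `x c` lies in one of the two blocks that `v` lists for `i₀` and
  -- `b`.
  have hor : ∀ c, ∀ b ≠ i₀, update (update t i₀ (x c)) b v ∈ H (listed i₀ Set.univ b i₀) ∨
      update (update t i₀ (x c)) b v ∈ H (listed b Set.univ b i₀) := by
    intro c b hb
    have h1 : update (update (update t i₀ (x c)) b v) b (t b) ∈ H (colorClass c) := by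
      rw [update_idem, update_eq_iff.2 ⟨by simp [hb], fun _ _ => rfl⟩]
      exact hx c
    have h2 : update (update (update t i₀ (x c)) b v ∘ Equiv.swap i₀ b) b (t b) ∈
        H (labelled i₀) := by
      convert hv using 1
      funext i
      rcases eq_or_ne i b with rfl | hib
      · simp [hb]
      rcases eq_or_ne i i₀ with rfl | hi0
      · simp [hib]
      · simp [hib, hi0, Equiv.swap_apply_of_ne_of_ne]
    have h3 := hH.mem_cyl h1
    have h4 := hH.mem_swap (hH.mem_cyl h2)
    refine hH.mem_sup (hH.mem_inf h3 h4) ?_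
    rintro ⟨s, d⟩ ⟨⟨a, c', hac, -⟩, hs⟩
    exact listed_of_transv_of_labelled hb d ⟨a, hac⟩ hs
  -- Comparing `b = i₁` with `b = i₂`, with `v` copied to both places, leaves only the common block
  -- `i₀`.
  have hlist : ∀ c, update (update t i₀ (x c)) i₁ v ∈ H (listed i₀ Set.univ i₁ i₀) := by
    intro c
    refine (hor c i₁ h01.symm).resolve_right fun hl => ?_
    have h1 : update (update t i₀ (x c)) i₁ v ∘ update id i₂ i₁ ∈ H (listed i₁ Set.univ i₂ i₀) :=
      hH.comp_repl_mem hl fun s c hs => by simpa [mem_listed, h02] using hs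
    have h2 : update (update t i₀ (x c)) i₁ v ∘ update id i₂ i₁ =
        update (update (update t i₀ (x c)) i₂ v) i₁ v := by
      rw [comp_update, comp_id, update_self]
      funext k
      by_cases k1 : k = i₁ <;> by_cases k2 : k = i₂ <;> simp_all
    rw [h2] at h1
    rcases hor c i₂ h02.symm with h3 | h3
    · exact hH.disjoint h1 (hH.update_mem v h3 (listed_of_update h12.symm h01))
        (listed_disjoint h01.symm)
    · exact hH.disjoint h1 (hH.update_mem v h3 (listed_of_update h12.symm h01))
        (listed_disjoint h12)
  have hy : ∀ c, ∃ y, update (update t i₀ (x c)) i₁ v ∈ H (listed i₀ {y} i₁ i₀) := fun c =>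
    hH.exists_mem_of_finite _ (hlist c) <| by
      rintro q ⟨v, hv, y, -, hy⟩
      exact Set.mem_iUnion.2 ⟨y, v, hv, y, rfl, hy⟩
  choose y hy using hy
  obtain ⟨c, c', hne, heq⟩ := Fintype.exists_ne_map_eq_of_card_lt y hcard
  -- With `x c` at `i₀`, `v` at `i₁` and `x c'` at `i₂`, both points bear the name `y c`.
  have h1 : update (update (update t i₀ (x c)) i₁ v) i₂ (x c') ∈ H (listed i₀ {y c} i₁ i₀) :=
    hH.update_mem _ (hy c) (listed_of_update h12 h02)
  have h2 : update (update (update t i₀ (x c)) i₁ v) i₂ (x c') ∈ H (listed i₀ {y c} i₁ i₂) := by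
    have h3 : update (update t i₀ (x c')) i₁ v ∘ update id i₂ i₀ ∈ H (listed i₀ {y c} i₁ i₂) :=
      hH.comp_repl_mem (heq ▸ hy c') fun s c hs => by simpa [mem_listed, h12] using hs
    convert hH.update_mem (x c) h3 (listed_of_update h01.symm h02.symm) using 1
    rw [comp_update]
    simp only [comp_id, update_of_ne h01, update_self]
    funext k
    by_cases k0 : k = i₀ <;> by_cases k1 : k = i₁ <;> by_cases k2 : k = i₂ <;> simp_all
  have h3 : x c = x c' := by
    have := hH.apply_eq (i := i₀) (j := i₂) (hH.mem_inf h1 h2) <| by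
      rintro q ⟨⟨v, hv, y, rfl, hy⟩, v', hv', y', rfl, hy'⟩
      rw [hv, Sum.inr.injEq] at hv'
      subst hv'
      rw [hy, hy']
    simpa [h01, h02] using this
  have h4 := hx c
  rw [h3] at h4
  refine hH.disjoint h4 (hx c') ?_
  rintro q ⟨⟨-, hq⟩, -, hq'⟩
  exact hne (hq.symm.trans hq')

end Nonrepresentable

/-! ### Choice of sizes and conclusion. -/

section Main

variable {ι : Type u}

theorem exists_isFull {Y C D : Type} [AddCommGroup Y] {ρ : C → D} {g : Y → C}
    (hg : ∀ c, ∃ y, ρ (g y) = ρ c) : ∃ χ : (ι → Y) → C, IsFull ρ χ := by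
  classical
  obtain ⟨σ, hσ⟩ := exists_sum ι Y
  refine ⟨g ∘ σ, fun b j c => ?_⟩
  obtain ⟨y, hy⟩ := hg c
  -- This entry makes the sum equal to `y`.
  refine ⟨y - σ b + b j, ?_⟩
  have h := hσ b j (y - σ b + b j)
  rw [add_sub_cancel_right, add_sub_cancel] at h
  rw [comp_apply, h, hy]

/-- `ρ` records which of the given elements contain the transversals of a colour; as these form one
orbit, testing `s₀` suffices. -/
theorem exists_sat {Y C : Type} [Nonempty Y] {V : Finset ℕ} (v : ℕ → ColAlg ι Y C) :
    ∃ ρ : C → V → Prop, ∀ x ∈ V, v x ∈ satSub (ι := ι) (Y := Y) ρ := by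
  let s₀ : ι → Base ι Y Y := fun i => Sum.inl (i, Classical.arbitrary Y)
  have h₀ : s₀ ∈ transv ι Y Y := ⟨1, _, fun _ => rfl⟩
  refine ⟨fun c x => (s₀, c) ∈ (v x).1, fun x hx s c c' hc h => ?_⟩
  by_cases hs : s ∈ transv ι Y Y
  · have := congrFun hc ⟨x, hx⟩
    exact (v x).2.of_transv h₀ hs (this.mp ((v x).2.of_transv hs h₀ h))
  · exact (v x).2.color s c c' hs h

/-- For every `k` there is a nonrepresentable algebra with representable diagonal-free reduct all
of whose `k`-generated subalgebras are representable. -/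
theorem exists_nonrepresentable (ι : Type u) [Infinite ι] (k : ℕ) :
    ∃ (A : Type u) (_ : (lang ι).Structure A), ¬ IsRepresentable ι A ∧
      IsDiagFreeRepresentable ι A ∧ ∀ V : Finset ℕ, V.card ≤ k → ∀ v : ℕ → A,
        ∃ S : (lang ι).Substructure A, IsRepresentable ι S ∧ ∀ x ∈ V, v x ∈ S := by
  classical
  -- One point for each subset of `k` elements, and one colour more.
  let Y := ZMod (2 ^ k)
  let C := ZMod (2 ^ k + 1)
  have hY : Fintype.card Y = 2 ^ k := ZMod.card _
  have hC : Fintype.card C = 2 ^ k + 1 := ZMod.card _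
  refine ⟨ColAlg ι Y C, inferInstance, ?_, ?_, ?_⟩
  · let e := Infinite.natEmbedding ι
    exact not_isRepresentable_colAlg (by lia) (e.injective.ne (by decide : (0 : ℕ) ≠ 1))
      (e.injective.ne (by decide : (0 : ℕ) ≠ 2)) (e.injective.ne (by decide : (1 : ℕ) ≠ 2))
  · obtain ⟨p, hp⟩ : ∃ p : C → Y, Surjective p := by
      obtain ⟨f⟩ := Function.Embedding.nonempty_of_card_le (α := Y) (β := C) (by lia)
      exact ⟨invFun f, invFun_surjective f.injective⟩
    obtain ⟨χ, hχ⟩ := exists_isFull (ι := ι) (ρ := (id : C → C)) (g := id) fun c => ⟨c, rfl⟩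
    exact isDiagFreeRepresentable_colAlg hp hχ
  · intro V hV v
    obtain ⟨ρ, hρ⟩ := exists_sat (V := V) v
    obtain ⟨g, hg⟩ : ∃ g : Y → C, ∀ c, ∃ y, ρ (g y) = ρ c := by
      have hcard : Fintype.card (Set.range ρ) ≤ Fintype.card Y := by
        refine (set_fintype_card_le_univ _).trans ?_
        rw [hY, Fintype.card_fun, Fintype.card_prop, Fintype.card_coe]
        exact Nat.pow_le_pow_right (by norm_num) hV
      obtain ⟨f⟩ := Function.Embedding.nonempty_of_card_le hcard
      have : Nonempty (Set.range ρ) := ⟨⟨_, 0, rfl⟩⟩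
      -- Each point gets a colour from the class it encodes; points outside the range of `f` get an
      -- arbitrary class.
      refine ⟨fun y => (invFun f y).2.choose, fun c => ⟨f ⟨ρ c, c, rfl⟩, ?_⟩⟩
      rw [(invFun f _).2.choose_spec, leftInverse_invFun f.injective]
    obtain ⟨χ, hχ⟩ := exists_isFull (ι := ι) hg
    exact ⟨satSub ρ, isRepresentable_satSub hχ, hρ⟩

end Main

end QEA

theorem mainTheorem3 (α : Ordinal.{u}) (hα : Ordinal.omega0 ≤ α) :
    -- no axiomatization by quantifier-free formulas in finitely many variables
    (¬ ∃ (S : Set ((QEA.lang α.ToType).Formula ℕ)) (V : Finset ℕ),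
        (∀ φ ∈ S, φ.IsQF ∧ φ.freeVarFinset ⊆ V) ∧ QEA.Axiomatizes S) ∧
    -- long formulas with diagonal elements are unavoidable
    (∀ (k : ℕ) (S : Set ((QEA.lang α.ToType).Formula ℕ)),
        (∀ φ ∈ S, φ.IsQF) → QEA.Axiomatizes S →
          ∃ φ ∈ S, k < φ.freeVarFinset.card ∧ QEA.HasDiag φ) ∧
    -- no such axiomatization over the diagonal-free reduct
    (¬ ∃ (S : Set ((QEA.lang α.ToType).Formula ℕ)) (V : Finset ℕ),
        (∀ φ ∈ S, φ.IsQF ∧ φ.freeVarFinset ⊆ V) ∧ QEA.AxiomatizesOverDiagFree S) := by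
  have hinf : Infinite α.ToType := by
    rw [Cardinal.infinite_iff, Cardinal.mk_toType]
    exact Ordinal.aleph0_le_card.2 hα
  refine ⟨?_, ?_, ?_⟩
  · rintro ⟨S, V, hS, hax⟩
    obtain ⟨A, _, hA, -, hsub⟩ := QEA.exists_nonrepresentable α.ToType V.card
    refine hA ((hax A).1 fun φ hφ v => ?_)
    obtain ⟨B, hB, hv⟩ := hsub V le_rfl v
    exact QEA.realize_of_substructure B (hS φ hφ).1 ((hax B).2 hB φ hφ) v
      fun x hx => hv x ((hS φ hφ).2 hx)
  · intro k S hS hax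
    by_contra! hcon
    obtain ⟨A, _, hA, hdf, hsub⟩ := QEA.exists_nonrepresentable α.ToType k
    refine hA ((hax A).1 fun φ hφ v => ?_)
    -- Short formulas are checked in representable subalgebras, long ones, being diagonal-free, in
    -- the reduct.
    rcases le_or_gt φ.freeVarFinset.card k with hk | hk
    · obtain ⟨B, hB, hv⟩ := hsub _ hk v
      exact QEA.realize_of_substructure B (hS φ hφ) ((hax B).2 hB φ hφ) v hv
    · exact hdf.realize (hS φ hφ) (hcon φ hφ hk) (fun B _ hB => (hax B).2 hB φ hφ) v
  · rintro ⟨S, V, hS, hax⟩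
    obtain ⟨A, _, hA, hdf, hsub⟩ := QEA.exists_nonrepresentable α.ToType V.card
    refine hA ((hax A hdf).1 fun φ hφ v => ?_)
    obtain ⟨B, hB, hv⟩ := hsub V le_rfl v
    exact QEA.realize_of_substructure B (hS φ hφ).1
      ((hax B hB.isDiagFreeRepresentable).2 hB φ hφ) v fun x hx => hv x ((hS φ hφ).2 hx)
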